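/- Let $\omega=e^{2\pi i/3}$. A $\mathbb Z_3$-space is a topological space with a continuous self-map, also written $\omega$, whose third iterate is the identity; a continuous map $f$ between $\mathbb Z_3$-spaces is equivariant if $f\omega=\omega f$, and two maps $X\to Y$ are equivariantly homotopic if there is a homotopy $h\colon X\times[0,1]\to Y$ between them such that every $h(\cdot,t)$ is equivariant. Let $\mathbb Z_3$ act on the unit circle $S^1\subset\mathbb C$ by $z\mapsto\omega z$ and on the torus $T^n=(S^1)^n$ diagonally. Let $P^2$ be a $\mathbb Z_3$-space obtained as follows. Let $Y_2$ be the circle $S^1$ with three $2$-discs $d_0,d_1,d_2$ glued on, $d_j$ along the map $\partial D^2=S^1\to S^1$, $z\mapsto\omega^jz$; the generator $\omega$ rotates the circle by $2\pi/3$ and maps $d_j$ identically to $d_{j+1}$ (indices modulo $3$). Put $Y_3=Y_2$. For $k\ge 3$, fix based maps $\gamma_i\colon S^k\to Y_k$ whose classes generate $\pi_k(Y_k)$, and let $Y_{k+1}$ be $Y_k$ with three $(k+1)$-discs glued on for each $i$, along $\gamma_i$, $\omega\gamma_i$ and $\omega^2\gamma_i$; the action is extended by permuting these three discs cyclically. Finally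 $P^2=\bigcup_k Y_k$ with the direct limit topology. Fix an equivariant embedding $\iota\colon S^1\hookrightarrow P^2$ (for example the inclusion of $S^1\subset Y_2$). For $n\ge 1$ let $$\mathscr Z_3^{(n)}=\Bigl\{\alpha\in\mathbb Z_3^n : \sum_{i=1}^n\alpha_i=1\Bigr\},$$ and for $\alpha\in\mathscr Z_3^{(n)}$, with its entries represented by integers $\alpha_i\in\{0,1,2\}$, let $m_\alpha\colon T^n\to P^2$ be the monomial map $$m_\alpha(z_1,\dots,z_n)=\iota\bigl(z_1^{\alpha_1}\cdots z_n^{\alpha_n}\bigr).$$ **Lemma.** Let $\alpha,\beta\in\mathscr Z_3^{(n)}$. If $m_\alpha$ and $m_\beta$ are equivariantly homotopic, then $\alpha=\beta$. -/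

import Mathlib

open Metric

/-- A topological space with an action of the cyclic group of order three, given by the
continuous map `ω` through which the generator acts. The base point is not required to be fixed
by anything; it serves only to speak of homotopy groups. -/
structure Z3Space where
  carrier : Type
  [top : TopologicalSpace carrier]
  pt : carrier
  ω : C(carrier, carrier)
  ω_cube : ∀ x, ω (ω (ω x)) = x

instance : CoeSort Z3Space Type := ⟨Z3Space.carrier⟩

attribute [instance] Z3Space.top

namespace Z3Space

/-- A continuous map that commutes with the actions. -/
def IsEquivariant {X Y : Z3Space} (f : C(X, Y)) : Prop :=
  ∀ x, f (X.ω x) = Y.ω (f x)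

/-- Existence of a homotopy all of whose stages are equivariant. -/
def EquivariantlyHomotopic {X Y : Z3Space} (f g : C(X, Y)) : Prop :=
  ∃ h : ContinuousMap.Homotopy f g, ∀ t x, h (t, X.ω x) = Y.ω (h (t, x))

section Attach

variable (Y : Z3Space) {E : Type} [NormedAddCommGroup E] {I : Type}
  (γ : I → C(sphere (0 : E) 1, Y))

/-- A boundary point `x` of the `j`-th disc belonging to `γ i` is glued to `ω ^ j • γ i x`. -/
inductive AttachRel :
    (Y ⊕ (Σ _ : I × ZMod 3, closedBall (0 : E) 1)) →
      (Y ⊕ (Σ _ : I × ZMod 3, closedBall (0 : E) 1)) → Prop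
  | glue (i : I) (j : ZMod 3) (x : sphere (0 : E) 1) :
      AttachRel (Sum.inr ⟨(i, j), ⟨x.1, sphere_subset_closedBall x.2⟩⟩)
        (Sum.inl (Y.ω^[j.val] (γ i x)))

theorem attach_shift (j : ZMod 3) (y : Y) :
    Y.ω^[(j + 1).val] y = Y.ω (Y.ω^[j.val] y) := by
  fin_cases j
  · rfl
  · rfl
  · exact (Y.ω_cube y).symm

/-- The action on the disjoint union of `Y` and the discs: `ω` on `Y`, and the `j`-th disc of
each orbit goes identically to the `(j + 1)`-st. -/
def preAttachω (p : Y ⊕ (Σ _ : I × ZMod 3, closedBall (0 : E) 1)) :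
    Y ⊕ (Σ _ : I × ZMod 3, closedBall (0 : E) 1) :=
  Sum.map Y.ω (Sigma.map (fun a => (a.1, a.2 + 1)) (fun _ x => x)) p

theorem continuous_preAttachω :
    Continuous (preAttachω Y : Y ⊕ (Σ _ : I × ZMod 3, closedBall (0 : E) 1) → _) :=
  Continuous.sumMap Y.ω.continuous (Continuous.sigma_map fun _ => continuous_id)

theorem attachRel_preAttachω {p q : Y ⊕ (Σ _ : I × ZMod 3, closedBall (0 : E) 1)}
    (h : AttachRel Y γ p q) : AttachRel Y γ (preAttachω Y p) (preAttachω Y q) := by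
  cases h with
  | glue i j x =>
    have := AttachRel.glue (γ := γ) i (j + 1) x
    rw [attach_shift] at this
    exact this

/-- The space obtained from `Y` by gluing, for each `i`, three copies of the unit disc of `E`
along `γ i`, `ω • γ i` and `ω ^ 2 • γ i`, with the quotient topology; the action permutes the
three discs cyclically. -/
def attach : Z3Space where
  carrier := Quot (AttachRel Y γ)
  top := inferInstance
  pt := Quot.mk _ (Sum.inl Y.pt)
  ω := ⟨Quot.map (preAttachω Y) fun _ _ h => attachRel_preAttachω Y γ h,
    continuous_quot_lift _ (continuous_quot_mk.comp (continuous_preAttachω Y))⟩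
  ω_cube := by
    rintro ⟨y | ⟨⟨i, j⟩, x⟩⟩
    · exact congrArg (fun z => Quot.mk _ (Sum.inl z)) (Y.ω_cube y)
    · have : j + 1 + 1 + 1 = j := by revert j; decide
      exact congrArg (fun k => Quot.mk (AttachRel Y γ) (Sum.inr ⟨(i, k), x⟩)) this

/-- The inclusion of `Y` into the space with discs glued on. -/
def attachIncl : C(Y, attach Y γ) :=
  ⟨fun y => Quot.mk _ (Sum.inl y), continuous_quot_mk.comp continuous_inl⟩

end Attach

end Z3Space

open Z3Space

noncomputable section

/-- The primitive cube root of unity `exp (2 π i / 3)`. -/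
def omega3 : Circle := Circle.exp (2 * Real.pi / 3)

theorem omega3_cube : omega3 * (omega3 * omega3) = 1 := by
  rw [omega3, ← Circle.exp_add, ← Circle.exp_add, ← Circle.exp_two_pi]
  congr 1
  ring

/-- The torus `(S¹)ⁿ`, with the diagonal rotation by `2 π / 3`. -/
def torus (n : ℕ) : Z3Space where
  carrier := Fin n → Circle
  pt := 1
  ω := ⟨fun z i => omega3 * z i, by fun_prop⟩
  ω_cube z := by
    funext i
    simp only [ContinuousMap.coe_mk]
    rw [← mul_assoc, ← mul_assoc, mul_assoc omega3, omega3_cube, one_mul]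

/-- The circle with the rotation by `2 π / 3`. -/
def circle3 : Z3Space where
  carrier := Circle
  pt := 1
  ω := ⟨fun z => omega3 * z, by fun_prop⟩
  ω_cube z := by
    simp only [ContinuousMap.coe_mk]
    rw [← mul_assoc, ← mul_assoc, mul_assoc omega3, omega3_cube, one_mul]

/-- The boundary of the unit disc in `ℂ`, identified with the circle. -/
def sphereToCircle : C(sphere (0 : ℂ) 1, circle3) :=
  ⟨fun x => (⟨x.1, x.2⟩ : Circle), Continuous.subtype_mk continuous_subtype_val _⟩

/-- The circle with three discs glued along it, the `j`-th one by the rotation `z ↦ ω ^ j z`;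
the action rotates the circle and permutes the discs cyclically. -/
def Y2 : Z3Space := attach circle3 (fun _ : Unit => sphereToCircle)

/-- An identification of the `k`-sphere, with base point `pole`, with the cube modulo its
boundary. -/
structure CubeCollapse (k : ℕ) where
  map : C(Fin k → unitInterval, sphere (0 : EuclideanSpace ℝ (Fin (k + 1))) 1)
  pole : sphere (0 : EuclideanSpace ℝ (Fin (k + 1))) 1
  map_eq_pole_iff : ∀ x, map x = pole ↔ x ∈ Cube.boundary (Fin k)
  injOn : Set.InjOn map (Cube.boundary (Fin k))ᶜ
  surjective : Function.Surjective map

/-- The element of the `k`-th homotopy group represented by a based map from the `k`-sphere. -/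
def CubeCollapse.toHomotopyGroup {k : ℕ} (q : CubeCollapse k) {Y : Type} [TopologicalSpace Y]
    {y : Y} (γ : C(sphere (0 : EuclideanSpace ℝ (Fin (k + 1))) 1, Y)) (hγ : γ q.pole = y) :
    HomotopyGroup (Fin k) Y y :=
  Quotient.mk _ ⟨γ.comp q.map, fun x hx =>
    (congrArg γ ((q.map_eq_pole_iff x).2 hx)).trans hγ⟩

/-- A family of based maps from the `k`-sphere whose classes generate the `k`-th homotopy group
of `Y`. -/
structure SphereGenerators (k : ℕ) [NeZero k] (Y : Z3Space) where
  collapse : CubeCollapse k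
  Index : Type
  γ : Index → C(sphere (0 : EuclideanSpace ℝ (Fin (k + 1))) 1, Y)
  based : ∀ i, γ i collapse.pole = Y.pt
  generate :
    Subgroup.closure (Set.range fun i => collapse.toHomotopyGroup (γ i) (based i)) = ⊤

/-- A rule that fixes representatives of generators for all homotopy groups `π_k`, `k ≥ 3`, that
can come up in the inductive construction below. -/
def GeneratorChoice : Type 1 :=
  ∀ (m : ℕ) (Y : Z3Space), SphereGenerators (m + 3) Y

/-- The skeleta `Y_{m + 3}`: one starts from `Y_3 = Y_2`, and `Y_{k + 1}` arises from `Y_k` by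
gluing three `(k + 1)`-discs for each of the chosen generators of `π_k(Y_k)`. -/
def skeleton (c : GeneratorChoice) : ℕ → Z3Space
  | 0 => Y2
  | m + 1 => attach (skeleton c m) (c m (skeleton c m)).γ

/-- The inclusion of each skeleton into the next. -/
def skeletonIncl (c : GeneratorChoice) (m : ℕ) : C(skeleton c m, skeleton c (m + 1)) :=
  attachIncl (skeleton c m) (c m (skeleton c m)).γ

/-- A point of a skeleton is identified with its image in the next one. -/
inductive UnionRel (c : GeneratorChoice) :
    (Σ m, skeleton c m) → (Σ m, skeleton c m) → Prop
  | step (m : ℕ) (y : skeleton c m) : UnionRel c ⟨m, y⟩ ⟨m + 1, skeletonIncl c m y⟩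

/-- The action on the disjoint union of the skeleta. -/
def preUnionω (c : GeneratorChoice) : (Σ m, skeleton c m) → (Σ m, skeleton c m) :=
  Sigma.map id fun m => (skeleton c m).ω

theorem continuous_preUnionω (c : GeneratorChoice) : Continuous (preUnionω c) :=
  Continuous.sigma_map (σ := fun m => skeleton c m) (τ := fun m => skeleton c m)
    fun m => (skeleton c m).ω.continuous

/-- The space `P²`: the union of the skeleta, with the weak (direct limit) topology. -/
def P2 (c : GeneratorChoice) : Z3Space where
  carrier := Quot (UnionRel c)
  top := inferInstance
  pt := Quot.mk _ ⟨0, (skeleton c 0).pt⟩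
  ω := ⟨Quot.map (preUnionω c) (by
      rintro _ _ ⟨m, y⟩
      exact UnionRel.step m ((skeleton c m).ω y)),
    continuous_quot_lift _ (continuous_quot_mk.comp (continuous_preUnionω c))⟩
  ω_cube := by
    rintro ⟨m, y⟩
    exact congrArg (fun z => Quot.mk (UnionRel c) ⟨m, z⟩) ((skeleton c m).ω_cube y)

/-- The `n`-ary affine maps modulo `3`, as coefficient tuples with sum `1`. -/
def AffineTuples (n : ℕ) : Set (Fin n → ZMod 3) := {α | ∑ i, α i = 1}

/-- The monomial `z ↦ z₁ ^ a₁ ⋯ zₙ ^ aₙ` on the torus. -/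
def monomial {n : ℕ} (a : Fin n → ℤ) : C(Fin n → Circle, Circle) :=
  ⟨fun z => ∏ i, z i ^ a i,
    continuous_finsetProd _ fun i _ => (continuous_apply i).zpow (a i)⟩

/-- The map `z ↦ ι (z₁ ^ a₁ ⋯ zₙ ^ aₙ)` for integer exponents. -/
def monomialMap {P : Z3Space} (ι : C(circle3, P)) {n : ℕ} (a : Fin n → ℤ) : C(torus n, P) :=
  ContinuousMap.comp (β := circle3) ι (monomial a)

/-- The monomial map of a tuple modulo `3`, with the exponents taken in `{0, 1, 2}`. -/
def monomialMap3 {P : Z3Space} (ι : C(circle3, P)) {n : ℕ} (α : Fin n → ZMod 3) :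
    C(torus n, P) :=
  monomialMap ι fun i => ((α i).val : ℤ)

end

/-! Let L be the space `LineTriple`: triples of nonzero vectors of ℓ² modulo scalar triples with
product 1. Nonzero vectors form a contractible space and (ℂ*)² acts freely on the triples, so L is a
K(ℤ², 2). The map `turn` induces an action of order three on L, because its third iterate multiplies
all three vectors by ω, and ω³ = 1.

There is an equivariant map P² → L (`exists_equivariant_P2`): an explicit formula handles the circle
and the 2-discs, and the higher discs give no obstruction since π_k(L) = 0 for k ≥ 3. It therefore
suffices to tell the monomial maps apart in L.

Restrict an equivariant homotopy of maps T^n → L to a square (s, t), where s rotates all coordinates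
by a third of a turn in total and t turns the coordinate i₀ once. A lift to triples closes up only
up to twists, G along the t-direction and K along the s-direction. Comparing the two ways to the far
corner gives ν = G 1 - τ(G 0) - (K 1 - K 0) with τ = `turnExp`. It lies in (2πiℤ)², so it is
constant along the homotopy. For a monomial with exponent a at i₀, the t-direction runs a times
around the circle, each time contributing `thirdExp`, the twist of the third iterate of `turn`.
Hence ν = (1 - τ)(a • thirdExp + m) with m in (2πiℤ)² (`monodromy_defect_eq`). The coordinates of (1
- τ)d differ by 3 d.1, so ν determines 2πia/3 modulo 2πi, that is, a modulo 3 (`modEq_of_homotopy`).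
-/

noncomputable section

open Complex unitInterval

/-! ### Continuous logarithms and compact quotients -/

instance : ContractibleSpace I :=
  (convex_Icc (0 : ℝ) 1).contractibleSpace ⟨0, by simp⟩

instance {J : Type*} : ContractibleSpace (J → I) := by
  rw [contractible_iff_id_nullhomotopic]
  exact ⟨0, ⟨{ toFun := fun p j => σ p.1 * p.2 j
               continuous_toFun := by fun_prop
               map_zero_left := fun x => by ext; simp
               map_one_left := fun x => by ext; simp }⟩⟩

/-- A nullhomotopy of the identity joins `f` to a constant; lifted through the covering `exp` from a
constant logarithm, it ends at a logarithm of `f`. -/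
theorem exists_continuous_log {X : Type*} [TopologicalSpace X] [ContractibleSpace X]
    (f : X → ℂ) (hf : Continuous f) (h0 : ∀ x, f x ≠ 0) :
    ∃ L : C(X, ℂ), ∀ x, exp (L x) = f x := by
  obtain ⟨x₀, ⟨H⟩⟩ := id_nullhomotopic X
  let g : C(I × X, {z : ℂ // z ≠ 0}) :=
    ⟨fun p => ⟨f (H.symm p), h0 _⟩, by fun_prop⟩
  have hg : ∀ x, g (0, x) = ⟨exp (ContinuousMap.const X (log (f x₀)) x), exp_ne_zero _⟩ := by
    intro x
    ext
    simp [g, exp_log (h0 x₀)]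
  refine ⟨(isCoveringMap_exp.liftHomotopy g _ hg).comp ⟨fun x => (1, x), by fun_prop⟩, fun x => ?_⟩
  have := congrArg Subtype.val (congrFun (isCoveringMap_exp.liftHomotopy_lifts g _ hg) (1, x))
  simpa [g] using this

theorem eq_of_exp_eq_exp {X : Type*} [TopologicalSpace X] [PreconnectedSpace X] {f : X → ℂ}
    (hf : Continuous f) (h : ∀ x y, exp (f x) = exp (f y)) (x y : X) : f x = f y :=
  congrFun (isCoveringMap_exp.eq_of_comp_eq hf (continuous_const (y := f y))
    (funext fun z => Subtype.ext (h z y)) y rfl) x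

theorem exists_descend {A B Z : Type*} [TopologicalSpace A] [TopologicalSpace B]
    [TopologicalSpace Z] [CompactSpace A] [T2Space B] (π : C(A, B)) (hπ : Function.Surjective π)
    (f : C(A, Z)) (hf : ∀ x y, π x = π y → f x = f y) : ∃ g : C(B, Z), ∀ x, g (π x) = f x := by
  have hq : Topology.IsQuotientMap π := π.continuous.isClosedMap.isQuotientMap π.continuous hπ
  exact ⟨hq.lift f fun x y => hf x y, fun x => DFunLike.congr_fun (hq.lift_comp f fun x y => hf x y) x⟩

/-! ### Nonzero vectors of the sequence space -/

/-- The Hilbert space of square summable sequences. -/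
def SeqSpace : Type := lp (fun _ : ℕ => ℂ) 2

instance : NormedAddCommGroup SeqSpace :=
  inferInstanceAs (NormedAddCommGroup (lp (fun _ : ℕ => ℂ) 2))

instance : InnerProductSpace ℂ SeqSpace :=
  inferInstanceAs (InnerProductSpace ℂ (lp (fun _ : ℕ => ℂ) 2))

instance : CompleteSpace SeqSpace :=
  inferInstanceAs (CompleteSpace (lp (fun _ : ℕ => ℂ) 2))

namespace SeqSpace

/-- The coordinate functionals. -/
def coord (n : ℕ) : SeqSpace →L[ℂ] ℂ := lp.evalCLM ℂ (fun _ : ℕ => ℂ) 2 n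

theorem ext_coord {x y : SeqSpace} (h : ∀ n, coord n x = coord n y) : x = y :=
  lp.ext (funext h)

/-- The unit vector at position `n`. -/
def unitVec (n : ℕ) : SeqSpace := (lp.single 2 n (1 : ℂ) : lp (fun _ : ℕ => ℂ) 2)

theorem coord_unitVec (n k : ℕ) : coord k (unitVec n) = if k = n then 1 else 0 := by
  change (lp.single 2 n (1 : ℂ) : lp (fun _ : ℕ => ℂ) 2) k = _
  simp [lp.single_apply, Pi.single_apply]

theorem norm_unitVec (n : ℕ) : ‖unitVec n‖ = 1 :=
  (lp.norm_single (p := 2) (E := fun _ : ℕ => ℂ) (by norm_num) n 1).trans (by simp)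

theorem inner_unitVec (n : ℕ) (x : SeqSpace) : inner ℂ (unitVec n) x = coord n x :=
  (lp.inner_single_left (G := fun _ : ℕ => ℂ) n (1 : ℂ) x).trans (by simp; rfl)

theorem orthogonalFamily_unitVec_succ :
    OrthogonalFamily ℂ (fun _ : ℕ => ℂ) fun n =>
      LinearIsometry.toSpanSingleton ℂ SeqSpace (norm_unitVec (n + 1)) := by
  intro i j hij a b
  simp [inner_smul_left, inner_smul_right, inner_unitVec, coord_unitVec, hij]

/-- The unilateral shift. -/
def shift : SeqSpace →ₗᵢ[ℂ] SeqSpace := orthogonalFamily_unitVec_succ.linearIsometry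

theorem hasSum_coord_shift (x : SeqSpace) (k : ℕ) :
    HasSum (fun i => coord i x * if k = i + 1 then 1 else 0) (coord k (shift x)) := by
  have := (orthogonalFamily_unitVec_succ.hasSum_linearIsometry x).mapL (coord k)
  simp only [LinearIsometry.toSpanSingleton_apply, map_smul, coord_unitVec] at this
  exact this

theorem coord_zero_shift (x : SeqSpace) : coord 0 (shift x) = 0 := by
  refine (hasSum_coord_shift x 0).unique ?_
  simp

theorem coord_succ_shift (x : SeqSpace) (n : ℕ) : coord (n + 1) (shift x) = coord n x := by
  refine (hasSum_coord_shift x (n + 1)).unique ?_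
  convert hasSum_ite_eq n (coord n x) using 2 with i
  by_cases h : i = n
  · simp [h]
  · simp [h, Ne.symm h]

/-- The shift is injective and has no eigenvectors: for `a ≠ 0` the coordinates of `x` would vanish
one after another. -/
theorem smul_add_shift_ne_zero {a b : ℂ} (hb : b ≠ 0) {x : SeqSpace} (hx : x ≠ 0) :
    a • x + b • shift x ≠ 0 := by
  intro h
  have hk : ∀ k, a * coord k x + b * coord k (shift x) = 0 := fun k => by
    simpa using congrArg (coord k) h
  refine hx (ext_coord fun n => ?_)
  rw [map_zero]
  by_cases ha : a = 0
  · simpa [ha, hb, coord_succ_shift] using hk (n + 1)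
  · induction n with
    | zero => simpa [ha, coord_zero_shift] using hk 0
    | succ n ih =>
      have := hk (n + 1)
      rw [coord_succ_shift, ih] at this
      simpa [ha] using this

theorem shift_add_unitVec_ne_zero {b c : ℂ} (hc : c ≠ 0) (x : SeqSpace) :
    b • shift x + c • unitVec 0 ≠ 0 := by
  intro h
  have := congrArg (coord 0) h
  simp [coord_zero_shift, coord_unitVec, hc] at this

theorem unitVec_ne_zero (n : ℕ) : unitVec n ≠ 0 := by
  rw [← norm_ne_zero_iff, norm_unitVec]
  exact one_ne_zero

end SeqSpace

open SeqSpace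

/-- The nonzero square summable sequences. -/
abbrev NonzeroSeq : Type := {x : SeqSpace // x ≠ 0}

/-- A contraction of the space of nonzero sequences, through the shift. -/
theorem exists_contraction_nonzeroSeq : ∃ c : C(I × NonzeroSeq, NonzeroSeq),
    (∀ x, c (0, x) = ⟨unitVec 0, unitVec_ne_zero 0⟩) ∧ ∀ x, c (1, x) = x := by
  -- Two segments: from `unitVec 0` to `shift x` up to time 1/2, then on to `x`. The direct segment
  -- from `unitVec 0` to `x` could pass through zero.
  let a : I → ℝ := fun t => max 0 (2 * t - 1)
  let b : I → ℝ := fun t => min (2 * t) (2 - 2 * t)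
  let d : I → ℝ := fun t => max 0 (1 - 2 * t)
  let F : I × NonzeroSeq → SeqSpace := fun p =>
    (a p.1 : ℂ) • p.2.1 + (b p.1 : ℂ) • shift p.2.1 + (d p.1 : ℂ) • unitVec 0
  have hF : Continuous F := by
    have := shift.continuous
    fun_prop
  have hne : ∀ p, F p ≠ 0 := by
    rintro ⟨t, x, hx⟩
    have h0 := t.2.1
    have h1 := t.2.2
    rcases lt_or_ge (2 * (t : ℝ)) 1 with h | h
    · have ha : a t = 0 := max_eq_left (by linarith)
      have hd : d t ≠ 0 := (lt_max_of_lt_right (by linarith : (0 : ℝ) < 1 - 2 * t)).ne'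
      simpa [F, ha] using shift_add_unitVec_ne_zero (b := b t) (c := (d t : ℂ)) 
        (by exact ofReal_ne_zero.2 hd) x
    · have hd : d t = 0 := max_eq_left (by linarith)
      rcases eq_or_lt_of_le h1 with h2 | h2
      · have hb : b t = 0 := by simp [b, h2]
        have ha : a t = 1 := by simp only [a, h2]; norm_num
        simpa [F, ha, hb, hd] using hx
      · have hb : b t ≠ 0 := (lt_min (by linarith) (by linarith : (0 : ℝ) < 2 - 2 * t)).ne'
        simpa [F, hd] using smul_add_shift_ne_zero (a := a t) (b := (b t : ℂ)) 
          (by exact ofReal_ne_zero.2 hb) hx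
  refine ⟨⟨fun p => ⟨F p, hne p⟩, by fun_prop⟩, fun x => ?_, fun x => ?_⟩
  · ext1
    simp [F, a, b, d]
  · ext1
    simp only [F, a, b, d, ContinuousMap.coe_mk, Set.Icc.coe_one]
    norm_num

/-- Multiplication of a nonzero sequence by the exponential of a complex number. -/
def expSmul (u : ℂ) (x : NonzeroSeq) : NonzeroSeq :=
  ⟨exp u • x.1, smul_ne_zero (exp_ne_zero u) x.2⟩

@[simp] theorem coe_expSmul (u : ℂ) (x : NonzeroSeq) : (expSmul u x : SeqSpace) = exp u • x.1 := rfl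

@[simp] theorem expSmul_zero (x : NonzeroSeq) : expSmul 0 x = x := by
  ext1; simp

@[simp] theorem expSmul_expSmul (u v : ℂ) (x : NonzeroSeq) :
    expSmul u (expSmul v x) = expSmul (u + v) x := by
  ext1; simp [exp_add, mul_smul]

theorem expSmul_left_injective (x : NonzeroSeq) {u v : ℂ} (h : expSmul u x = expSmul v x) :
    exp u = exp v :=
  smul_left_injective ℂ x.2 (congrArg Subtype.val h)

@[fun_prop]
theorem Continuous.expSmul {X : Type*} [TopologicalSpace X] {f : X → ℂ} {g : X → NonzeroSeq}
    (hf : Continuous f) (hg : Continuous g) : Continuous fun x => expSmul (f x) (g x) := by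
  unfold _root_.expSmul
  fun_prop

/-! ### Triples of lines with a trivialized tensor product -/

/-- Triples of nonzero sequences. -/
abbrev Triple : Type := NonzeroSeq × NonzeroSeq × NonzeroSeq

/-- The action of `ℂ × ℂ`, by scalars with product one. -/
def twist (D : ℂ × ℂ) (y : Triple) : Triple :=
  (expSmul (-(D.1 + D.2)) y.1, expSmul D.1 y.2.1, expSmul D.2 y.2.2)

@[simp] theorem twist_zero (y : Triple) : twist 0 y = y := by
  simp [twist]

@[simp] theorem twist_twist (D D' : ℂ × ℂ) (y : Triple) :
    twist D (twist D' y) = twist (D + D') y := by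
  simp only [twist, expSmul_expSmul, Prod.fst_add, Prod.snd_add]
  congr 2
  ring

@[fun_prop]
theorem Continuous.twist {X : Type*} [TopologicalSpace X] {f : X → ℂ × ℂ} {g : X → Triple}
    (hf : Continuous f) (hg : Continuous g) : Continuous fun x => twist (f x) (g x) := by
  unfold _root_.twist
  fun_prop

theorem exp_eq_of_twist_eq {D D' : ℂ × ℂ} {y : Triple} (h : twist D y = twist D' y) :
    exp D.1 = exp D'.1 ∧ exp D.2 = exp D'.2 :=
  ⟨expSmul_left_injective _ (congrArg (fun z : Triple => z.2.1) h),
    expSmul_left_injective _ (congrArg (fun z : Triple => z.2.2) h)⟩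

/-- Triples are identified along the action of scalars with product one. -/
instance tripleSetoid : Setoid Triple where
  r y y' := ∃ D, twist D y = y'
  iseqv :=
    { refl := fun y => ⟨0, twist_zero y⟩
      symm := by
        rintro y _ ⟨D, rfl⟩
        exact ⟨-D, by simp⟩
      trans := by
        rintro y _ _ ⟨D, rfl⟩ ⟨D', rfl⟩
        exact ⟨D' + D, by simp⟩ }

/-- The space of triples of lines with a trivialization of their tensor product. -/
abbrev LineTriple : Type := Quotient tripleSetoid

/-- The class of a triple. -/
def toLines (y : Triple) : LineTriple := Quotient.mk _ y

theorem toLines_eq_iff {y y' : Triple} : toLines y = toLines y' ↔ ∃ D, twist D y = y' :=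
  Quotient.eq

@[simp] theorem toLines_twist (D : ℂ × ℂ) (y : Triple) : toLines (twist D y) = toLines y :=
  (toLines_eq_iff.2 ⟨D, rfl⟩).symm

theorem isOpenQuotientMap_toLines : IsOpenQuotientMap toLines where
  surjective := Quotient.mk_surjective
  continuous := continuous_quotient_mk'
  isOpenMap := by
    intro U hU
    change IsOpen (toLines ⁻¹' (toLines '' U))
    have : toLines ⁻¹' (toLines '' U) = ⋃ D, twist D ⁻¹' U := by
      ext y
      simp only [Set.mem_preimage, Set.mem_image, Set.mem_iUnion]
      constructor
      · rintro ⟨y', hy', h⟩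
        obtain ⟨D, rfl⟩ := toLines_eq_iff.1 h.symm
        exact ⟨D, hy'⟩
      · rintro ⟨D, hD⟩
        exact ⟨_, hD, toLines_twist D y⟩
    rw [this]
    exact isOpen_iUnion fun D => hU.preimage (by fun_prop)

@[fun_prop]
theorem continuous_toLines : Continuous toLines := isOpenQuotientMap_toLines.continuous

/-- The ratio by which `x` has to be multiplied so that it pairs with `x₀` like `x₀` itself. -/
def pairingRatio (x₀ x : NonzeroSeq) : ℂ := inner ℂ x₀.1 x₀.1 / inner ℂ x₀.1 x.1

theorem pairingRatio_expSmul (x₀ x : NonzeroSeq) (u : ℂ) :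
    pairingRatio x₀ (expSmul u x) = exp (-u) * pairingRatio x₀ x := by
  simp only [pairingRatio, coe_expSmul, inner_smul_right, exp_neg]
  field_simp

theorem pairingRatio_self (x : NonzeroSeq) : pairingRatio x x = 1 :=
  div_self (inner_self_ne_zero.2 x.2)

theorem pairingRatio_ne_zero {x₀ x : NonzeroSeq} (h : inner ℂ x₀.1 x.1 ≠ 0) :
    pairingRatio x₀ x ≠ 0 :=
  div_ne_zero (inner_self_ne_zero.2 x₀.2) h

/-- The multiple of `y` that pairs with `y₀` like `y₀` itself in the last two components. -/
def transportTriple (y₀ y : Triple) : SeqSpace × SeqSpace × SeqSpace :=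
  ((pairingRatio y₀.2.1 y.2.1 * pairingRatio y₀.2.2 y.2.2)⁻¹ • y.1.1,
    pairingRatio y₀.2.1 y.2.1 • y.2.1.1, pairingRatio y₀.2.2 y.2.2 • y.2.2.1)

theorem transportTriple_twist (y₀ y : Triple) (D : ℂ × ℂ) :
    transportTriple y₀ (twist D y) = transportTriple y₀ y := by
  simp only [transportTriple, twist, pairingRatio_expSmul, coe_expSmul, smul_smul]
  refine Prod.ext ?_ (Prod.ext ?_ ?_)
  · simp only [neg_add, exp_add, exp_neg]
    congr 1
    field_simp
  · simp only [exp_neg]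
    congr 1
    field_simp
  · simp only [exp_neg]
    congr 1
    field_simp

/-- The representative of a class closest to a given triple. -/
def transport (p : Triple × LineTriple) : SeqSpace × SeqSpace × SeqSpace :=
  Quotient.lift (transportTriple p.1)
    (by rintro y _ ⟨D, rfl⟩; exact (transportTriple_twist p.1 y D).symm) p.2

/-- Two triples are near if their last two components are not orthogonal. -/
def NearTriple (y₀ y : Triple) : Prop :=
  inner ℂ y₀.2.1.1 y.2.1.1 ≠ 0 ∧ inner ℂ y₀.2.2.1 y.2.2.1 ≠ 0

theorem continuousAt_transport {y₀ y : Triple} (h : NearTriple y₀ y) :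
    ContinuousAt transport (y₀, toLines y) := by
  -- Products of open quotient maps are quotient maps, so continuity can be tested on
  -- representatives.
  have hq := (IsOpenQuotientMap.id (X := Triple)).prodMap isOpenQuotientMap_toLines
  change ContinuousAt transport (Prod.map id toLines (y₀, y))
  rw [← hq.continuousAt_comp_iff]
  change ContinuousAt (fun p : Triple × Triple => transportTriple p.1 p.2) (y₀, y)
  have h1 : ContinuousAt (fun p : Triple × Triple => pairingRatio p.1.2.1 p.2.2.1) (y₀, y) :=
    ContinuousAt.div (by fun_prop) (by fun_prop) h.1
  have h2 : ContinuousAt (fun p : Triple × Triple => pairingRatio p.1.2.2 p.2.2.2) (y₀, y) :=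
    ContinuousAt.div (by fun_prop) (by fun_prop) h.2
  have h3 := (h1.mul h2).inv₀ (mul_ne_zero (pairingRatio_ne_zero h.1) (pairingRatio_ne_zero h.2))
  exact (h3.smul (by fun_prop)).prodMk ((h1.smul (by fun_prop)).prodMk (h2.smul (by fun_prop)))

theorem transportTriple_eq {y₀ y : Triple} (h : NearTriple y₀ y) :
    ∃ D, transportTriple y₀ y =
      ((twist D y).1.1, (twist D y).2.1.1, (twist D y).2.2.1) := by
  have h1 := pairingRatio_ne_zero h.1
  have h2 := pairingRatio_ne_zero h.2
  refine ⟨(log (pairingRatio y₀.2.1 y.2.1), log (pairingRatio y₀.2.2 y.2.2)), ?_⟩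
  simp [transportTriple, twist, exp_add, exp_neg, exp_log h1, exp_log h2, mul_comm]

/-- The pairs of classes that have near representatives. -/
def nearLines : Set (LineTriple × LineTriple) :=
  Prod.map toLines toLines '' {p : Triple × Triple | NearTriple p.1 p.2}

theorem isOpen_nearLines : IsOpen nearLines := by
  refine (isOpenQuotientMap_toLines.prodMap isOpenQuotientMap_toLines).isOpenMap _ ?_
  exact (isOpen_ne_fun (by fun_prop) (by fun_prop)).inter
    (isOpen_ne_fun (by fun_prop) (by fun_prop))

theorem nearTriple_self (y : Triple) : NearTriple y y :=
  ⟨inner_self_ne_zero.2 y.2.1.2, inner_self_ne_zero.2 y.2.2.2⟩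

theorem mk_self_mem_nearLines (w : LineTriple) : (w, w) ∈ nearLines := by
  obtain ⟨y, rfl⟩ := isOpenQuotientMap_toLines.surjective w
  exact ⟨(y, y), nearTriple_self y, rfl⟩

theorem exists_nearTriple {y₀ : Triple} {w : LineTriple} (h : (toLines y₀, w) ∈ nearLines) :
    ∃ y, toLines y = w ∧ NearTriple y₀ y := by
  obtain ⟨⟨y₁, y⟩, hn, he⟩ := h
  obtain ⟨h1, rfl⟩ := Prod.ext_iff.1 he
  obtain ⟨D, rfl⟩ := toLines_eq_iff.1 h1
  refine ⟨y, rfl, ?_, ?_⟩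
  · simpa [twist, inner_smul_left, exp_ne_zero] using hn.1
  · simpa [twist, inner_smul_left, exp_ne_zero] using hn.2

/-- The lift is the representative of `g x` normalised by its pairings with `f x`. If `f x` already
lies over `g x`, both ratios are 1 and it is returned unchanged. -/
theorem exists_transport {X : Type*} [TopologicalSpace X] (f : C(X, Triple)) (g : C(X, LineTriple))
    (h : ∀ x, (toLines (f x), g x) ∈ nearLines) :
    ∃ f' : C(X, Triple), (∀ x, toLines (f' x) = g x) ∧ ∀ x, toLines (f x) = g x → f' x = f x := by
  have key : ∀ x, ∃ y : Triple, toLines y = g x ∧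
      transport (f x, g x) = (y.1.1, y.2.1.1, y.2.2.1) := by
    intro x
    obtain ⟨y, hy, hn⟩ := exists_nearTriple (h x)
    obtain ⟨D, hD⟩ := transportTriple_eq hn
    exact ⟨twist D y, by simpa using hy, by rw [← hy]; exact hD⟩
  choose F hF hT using key
  have hc : Continuous fun x => transport (f x, g x) := by
    rw [continuous_iff_continuousAt]
    intro x
    obtain ⟨y, hy, hn⟩ := exists_nearTriple (h x)
    have := continuousAt_transport hn
    rw [hy] at this
    exact ContinuousAt.comp (f := fun x => (f x, g x)) this (by fun_prop)
  simp only [hT] at hc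
  refine ⟨⟨F, ?_⟩, hF, fun x hx => ?_⟩
  · refine Continuous.prodMk ?_ (Continuous.prodMk ?_ ?_)
    · exact continuous_induced_rng.2 hc.fst
    · exact continuous_induced_rng.2 hc.snd.fst
    · exact continuous_induced_rng.2 hc.snd.snd
  · have h1 := hT x
    rw [← hx] at h1
    change transportTriple (f x) (f x) = _ at h1
    simp only [transportTriple, pairingRatio_self, mul_one, inv_one, one_smul, Prod.mk.injEq] at h1
    exact Prod.ext (Subtype.ext h1.1.symm)
      (Prod.ext (Subtype.ext h1.2.1.symm) (Subtype.ext h1.2.2.symm))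

/-- Homotopy lifting; stationary paths lift to stationary paths. -/
theorem exists_lift_homotopy {X : Type*} [TopologicalSpace X] [CompactSpace X]
    (F : C(I × X, LineTriple)) (f₀ : C(X, Triple)) (h₀ : ∀ x, toLines (f₀ x) = F (0, x)) :
    ∃ G : C(I × X, Triple), (∀ p, toLines (G p) = F p) ∧ (∀ x, G (0, x) = f₀ x) ∧
      ∀ x, (∀ t, F (t, x) = F (0, x)) → ∀ t, G (t, x) = f₀ x := by
  obtain ⟨δ, hδ, hnear⟩ : ∃ δ > 0, ∀ (x : X) (s t : I), dist s t < δ →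
      (F (s, x), F (t, x)) ∈ nearLines := by
    -- A Lebesgue number argument: `S` is compact and misses `s = t`, so the distance has a positive
    -- minimum on it.
    let S : Set (X × I × I) := {p | (F (p.2.1, p.1), F (p.2.2, p.1)) ∉ nearLines}
    have hS : IsClosed S := by
      refine IsClosed.preimage (f := fun p : X × I × I => (F (p.2.1, p.1), F (p.2.2, p.1)))
        ?_ isOpen_nearLines.isClosed_compl
      fun_prop
    rcases S.eq_empty_or_nonempty with he | hne
    · refine ⟨1, one_pos, fun x s t _ => ?_⟩
      by_contra hc
      have : (x, s, t) ∈ S := hc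
      simp [he] at this
    · obtain ⟨p, hp, hmin⟩ := hS.isCompact.exists_isMinOn hne
        (f := fun p : X × I × I => dist p.2.1 p.2.2) (by fun_prop)
      refine ⟨dist p.2.1 p.2.2, dist_pos.2 fun hc => ?_, fun x s t hst => ?_⟩
      · refine hp ?_
        rw [hc]
        exact mk_self_mem_nearLines _
      · by_contra hc
        exact absurd (hmin (show (x, s, t) ∈ S from hc)) (not_le.2 hst)
  obtain ⟨N, hN⟩ := exists_nat_gt δ⁻¹
  have hN0 : (0 : ℝ) < N := (inv_pos.2 hδ).trans hN
  have hN1 : (1 : ℝ) / N < δ := by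
    rw [one_div]
    exact inv_lt_of_inv_lt₀ hδ hN
  -- Stage `n` lifts the homotopy stopped at time `n / N`; consecutive stages are near enough for
  -- transport.
  let c : ℕ → I → I := fun n t => Set.projIcc 0 1 zero_le_one (min (t : ℝ) (n / N))
  have hc : ∀ n, Continuous (c n) := fun n => by
    have := continuous_projIcc (a := (0 : ℝ)) (b := 1) (h := zero_le_one)
    fun_prop
  have hc0 : ∀ n, c n 0 = 0 := fun n => by
    have : min (0 : ℝ) (n / N) = 0 := min_eq_left (by positivity)
    simp [c, this]
  have hcN : ∀ t, c N t = t := fun t => by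
    have : min (t : ℝ) (N / N) = t := by
      rw [div_self hN0.ne']
      exact min_eq_left t.2.2
    simp [c, this]
  have hstep : ∀ n t, dist (c n t) (c (n + 1) t) < δ := by
    intro n t
    refine lt_of_le_of_lt ?_ hN1
    have hle := (LipschitzWith.projIcc (zero_le_one (α := ℝ))).dist_le_mul
      (min (t : ℝ) (n / N)) (min (t : ℝ) ((n + 1 : ℕ) / N))
    refine hle.trans ?_
    rw [NNReal.coe_one, one_mul, Real.dist_eq]
    refine (abs_min_sub_min_le_max _ _ _ _).trans ?_
    rw [sub_self, abs_zero, max_eq_right (abs_nonneg _), abs_sub_comm, Nat.cast_add, Nat.cast_one,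
      add_div, add_sub_cancel_left, abs_of_nonneg (by positivity)]
  have main : ∀ n, ∃ G : C(I × X, Triple), (∀ p, toLines (G p) = F (c n p.1, p.2)) ∧
      (∀ x, G (0, x) = f₀ x) ∧ ∀ x, (∀ t, F (t, x) = F (0, x)) → ∀ t, G (t, x) = f₀ x := by
    intro n
    induction n with
    | zero =>
      refine ⟨⟨fun p => f₀ p.2, by fun_prop⟩, fun p => ?_, fun _ => rfl, fun _ _ _ => rfl⟩
      have : c 0 p.1 = 0 := by
        have : min (p.1 : ℝ) 0 = 0 := min_eq_right p.1.2.1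
        simp [c, this]
      simp [this, h₀]
    | succ n ih =>
      obtain ⟨G, hG, hG0, hGs⟩ := ih
      obtain ⟨G', hG', hGG'⟩ := exists_transport G
        ⟨fun p => F (c (n + 1) p.1, p.2), by have := hc (n + 1); fun_prop⟩
        (fun p => by rw [hG]; exact hnear _ _ _ (hstep n p.1))
      refine ⟨G', hG', fun x => ?_, fun x hx t => ?_⟩
      · rw [hGG', hG0]
        rw [hG]
        simp [hc0]
      · rw [hGG', hGs x hx]
        rw [hG]
        simp only [ContinuousMap.coe_mk]
        rw [hx, hx (c (n + 1) t)]
  obtain ⟨G, hG, hG0, hGs⟩ := main N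
  exact ⟨G, fun p => by rw [hG, hcN], hG0, hGs⟩

theorem exists_lift_of_contractible {X : Type*} [TopologicalSpace X] [CompactSpace X]
    [ContractibleSpace X] (f : C(X, LineTriple)) : ∃ g : C(X, Triple), ∀ x, toLines (g x) = f x := by
  obtain ⟨x₀, ⟨H⟩⟩ := id_nullhomotopic X
  obtain ⟨y, hy⟩ := isOpenQuotientMap_toLines.surjective (f x₀)
  obtain ⟨G, hG, -⟩ := exists_lift_homotopy (f.comp H.symm.toContinuousMap)
    (ContinuousMap.const X y) (fun x => by simpa using hy)
  exact ⟨G.comp ⟨fun x => (1, x), by fun_prop⟩, fun x => by simpa using hG (1, x)⟩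

/-- Two lifts of the same map differ by a continuous twist. -/
theorem exists_twist_of_toLines_eq {X : Type*} [TopologicalSpace X] [ContractibleSpace X]
    (f g : C(X, Triple)) (h : ∀ x, toLines (f x) = toLines (g x)) :
    ∃ D : C(X, ℂ × ℂ), ∀ x, g x = twist (D x) (f x) := by
  have key : ∀ x, ∃ D, twist D (f x) = g x := fun x => toLines_eq_iff.1 (h x)
  choose D hD using key
  -- The pointwise choice of `D` need not be continuous, but its exponential is a quotient of inner
  -- products.
  have h1 : ∀ x, exp (D x).1 = inner ℂ (f x).2.1.1 (g x).2.1.1 / inner ℂ (f x).2.1.1 (f x).2.1.1 := by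
    intro x
    rw [eq_div_iff (inner_self_ne_zero.2 (f x).2.1.2), ← hD x]
    simp [twist]
  have h2 : ∀ x, exp (D x).2 = inner ℂ (f x).2.2.1 (g x).2.2.1 / inner ℂ (f x).2.2.1 (f x).2.2.1 := by
    intro x
    rw [eq_div_iff (inner_self_ne_zero.2 (f x).2.2.2), ← hD x]
    simp [twist]
  obtain ⟨L₁, hL₁⟩ := exists_continuous_log (fun x => exp (D x).1)
    (by simp only [h1]
        exact Continuous.div (by fun_prop) (by fun_prop) fun x => inner_self_ne_zero.2 (f x).2.1.2)
    (fun x => exp_ne_zero _)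
  obtain ⟨L₂, hL₂⟩ := exists_continuous_log (fun x => exp (D x).2)
    (by simp only [h2]
        exact Continuous.div (by fun_prop) (by fun_prop) fun x => inner_self_ne_zero.2 (f x).2.2.2)
    (fun x => exp_ne_zero _)
  refine ⟨⟨fun x => (L₁ x, L₂ x), by fun_prop⟩, fun x => ?_⟩
  rw [← hD x]
  simp [twist, expSmul, exp_add, exp_neg, hL₁, hL₂]

/-! ### Maps from spheres into the space of line triples -/

/-- On each face `u` takes values in 2πiℤ and is constant by connectedness. Since `2 ≤ n`, every
face meets one of the form `x j = 0` with another direction `j`, and that one contains 0. -/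
theorem eq_on_cube_boundary {n : ℕ} (hn : 2 ≤ n) {u : (Fin n → I) → ℂ} (hu : Continuous u)
    (h : ∀ x ∈ Cube.boundary (Fin n), exp (u x) = 1) {x : Fin n → I}
    (hx : x ∈ Cube.boundary (Fin n)) : u x = u 0 := by
  have face : ∀ (i : Fin n) (e : I), (e = 0 ∨ e = 1) → ∀ x y : Fin n → I, x i = e → y i = e →
      u x = u y := by
    intro i e he x y hx hy
    have hb : ∀ z : Fin n → I, exp (u (Function.update z i e)) = 1 := fun z =>
      h _ ⟨i, by simpa using he⟩
    have := eq_of_exp_eq_exp (f := fun z => u (Function.update z i e)) (by fun_prop)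
      (fun z z' => (hb z).trans (hb z').symm) x y
    have hx' : Function.update x i e = x := by rw [← hx, Function.update_eq_self]
    have hy' : Function.update y i e = y := by rw [← hy, Function.update_eq_self]
    rwa [hx', hy'] at this
  obtain ⟨i, hi⟩ := hx
  have : Nontrivial (Fin n) := Fin.nontrivial_iff_two_le.2 hn
  obtain ⟨j, hj⟩ := exists_ne i
  calc u x = u (Function.update 0 i (x i)) := face i (x i) hi _ _ rfl (by simp)
    _ = u 0 := face j 0 (Or.inl rfl) _ _ (by simp [hj]) rfl

/-- The obstruction lies in π_{k-1}((ℂ*)²), which vanishes for k = m + 3. The first cube coordinate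
serves as time: the homotopy is lifted from a constant, and the twist at its end is then removed. -/
theorem exists_lift_sphere {m : ℕ} (q : CubeCollapse (m + 3))
    (f : C(sphere (0 : EuclideanSpace ℝ (Fin (m + 3 + 1))) 1, LineTriple)) :
    ∃ g : C(sphere (0 : EuclideanSpace ℝ (Fin (m + 3 + 1))) 1, Triple),
      ∀ x, toLines (g x) = f x := by
  obtain ⟨y₀, hy₀⟩ := isOpenQuotientMap_toLines.surjective (f q.pole)
  have hpole : ∀ z ∈ Cube.boundary (Fin (m + 3)), f (q.map z) = f q.pole := fun z hz =>
    congrArg f ((q.map_eq_pole_iff z).2 hz)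
  let F : C(I × (Fin (m + 2) → I), LineTriple) :=
    ⟨fun p => f (q.map (Fin.cons p.1 p.2 : Fin (m + 3) → I)), by fun_prop⟩
  have hside : ∀ x ∈ Cube.boundary (Fin (m + 2)), ∀ t, F (t, x) = f q.pole := by
    rintro x ⟨i, hi⟩ t
    exact hpole _ ⟨i.succ, by simpa using hi⟩
  have hend : ∀ t : I, (t = 0 ∨ t = 1) → ∀ x, F (t, x) = f q.pole := fun t ht x =>
    hpole _ ⟨0, by simpa using ht⟩
  obtain ⟨G, hG, hG0, hGs⟩ := exists_lift_homotopy F (ContinuousMap.const _ y₀)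
    (fun x => by rw [hend 0 (Or.inl rfl)]; exact hy₀)
  have hG1 : ∀ x ∈ Cube.boundary (Fin (m + 2)), ∀ t, G (t, x) = y₀ := fun x hx t =>
    hGs x (fun t => (hside x hx t).trans (hside x hx 0).symm) t
  obtain ⟨D, hD⟩ := exists_twist_of_toLines_eq (ContinuousMap.const _ y₀)
    (G.comp ⟨fun x => (1, x), by fun_prop⟩)
    (fun x => by simpa [hG, hend 1 (Or.inr rfl)] using hy₀)
  have hexp : ∀ x ∈ Cube.boundary (Fin (m + 2)), exp (D x).1 = 1 ∧ exp (D x).2 = 1 := by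
    intro x hx
    have h1 : twist (D x) y₀ = twist 0 y₀ := by
      rw [twist_zero]
      exact (hD x).symm.trans (hG1 x hx 1)
    simpa using exp_eq_of_twist_eq h1
  have hD0 : ∀ x ∈ Cube.boundary (Fin (m + 2)), D x = D 0 := fun x hx =>
    Prod.ext (eq_on_cube_boundary (u := fun x => (D x).1) (by omega) (by fun_prop)
      (fun z hz => (hexp z hz).1) hx)
      (eq_on_cube_boundary (u := fun x => (D x).2) (by omega) (by fun_prop)
      (fun z hz => (hexp z hz).2) hx)
  have h0mem : (0 : Fin (m + 2) → I) ∈ Cube.boundary (Fin (m + 2)) := ⟨0, Or.inl rfl⟩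
  -- `D 0` acts trivially on `y₀`; subtracting it makes the exponent vanish on the boundary, not
  -- only its exponential trivial.
  have hD' : ∀ x, G (1, x) = twist (D x - D 0) y₀ := by
    intro x
    have h1 : y₀ = twist (D 0) y₀ := (hG1 0 h0mem 1).symm.trans (hD 0)
    conv_rhs => rw [h1]
    rw [twist_twist, sub_add_cancel]
    exact hD x
  -- The end twist is undone linearly in time, so that the whole boundary goes to `y₀`.
  let K : C(Fin (m + 3) → I, Triple) :=
    ⟨fun z => twist (-(((z 0 : ℝ) : ℂ) • (D (Fin.tail z) - D 0))) (G (z 0, Fin.tail z)), by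
      have : Continuous (Fin.tail : (Fin (m + 3) → I) → Fin (m + 2) → I) := by
        unfold Fin.tail
        fun_prop
      fun_prop⟩
  have hK : ∀ z, toLines (K z) = f (q.map z) := by
    intro z
    simp only [K, ContinuousMap.coe_mk, toLines_twist, hG, F, Fin.cons_self_tail]
  have hKb : ∀ z ∈ Cube.boundary (Fin (m + 3)), K z = y₀ := by
    rintro z ⟨i, hi⟩
    simp only [K, ContinuousMap.coe_mk]
    refine Fin.cases (fun hi => ?_) (fun i hi => ?_) i hi
    · rcases hi with hi | hi
      · simp [hi, hG0]
      · simp [hi, hD']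
    · have hz : Fin.tail z ∈ Cube.boundary (Fin (m + 2)) := ⟨i, hi⟩
      simp [hD0 _ hz, hG1 _ hz]
  obtain ⟨g, hg⟩ := exists_descend q.map q.surjective K (by
    intro z z' hzz'
    by_cases hz : z ∈ Cube.boundary (Fin (m + 3))
    · have hz' := (q.map_eq_pole_iff z').1 (hzz' ▸ (q.map_eq_pole_iff z).2 hz)
      rw [hKb z hz, hKb z' hz']
    · have hz' : z' ∉ Cube.boundary (Fin (m + 3)) := fun hz' =>
        hz ((q.map_eq_pole_iff z).1 (hzz' ▸ (q.map_eq_pole_iff z').2 hz'))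
      rw [q.injOn hz hz' hzz'])
  refine ⟨g, fun x => ?_⟩
  obtain ⟨z, rfl⟩ := q.surjective x
  rw [hg, hK]

/-- The ball is the cone over the sphere, with the radius as the time of the contraction. -/
theorem exists_extend_ball_of_contraction {E Z : Type*} [NormedAddCommGroup E] [NormedSpace ℝ E]
    [ProperSpace E] [Nontrivial E] [TopologicalSpace Z] (c : C(I × Z, Z)) (z₀ : Z)
    (h0 : ∀ z, c (0, z) = z₀) (h1 : ∀ z, c (1, z) = z) (f : C(sphere (0 : E) 1, Z)) :
    ∃ g : C(closedBall (0 : E) 1, Z), ∀ x : sphere (0 : E) 1,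
      g ⟨x.1, sphere_subset_closedBall x.2⟩ = f x := by
  let π : C(I × sphere (0 : E) 1, closedBall (0 : E) 1) :=
    ⟨fun p => ⟨(p.1 : ℝ) • p.2.1, by
      simpa [norm_smul, abs_of_nonneg p.1.2.1] using p.1.2.2⟩, by fun_prop⟩
  have hnorm : ∀ p, ‖(π p).1‖ = p.1 := fun p => by
    simp [π, norm_smul, abs_of_nonneg p.1.2.1]
  have hπ : Function.Surjective π := by
    rintro ⟨b, hb⟩
    rw [mem_closedBall_zero_iff] at hb
    by_cases hb0 : b = 0
    · obtain ⟨x, hx⟩ := NormedSpace.sphere_nonempty (x := (0 : E)) (r := 1) |>.2 zero_le_one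
      exact ⟨(0, ⟨x, hx⟩), Subtype.ext (by simp [π, hb0])⟩
    · have hn : ‖b‖ ≠ 0 := norm_ne_zero_iff.2 hb0
      refine ⟨(⟨‖b‖, norm_nonneg b, hb⟩, ⟨‖b‖⁻¹ • b, ?_⟩), Subtype.ext ?_⟩
      · simp [norm_smul, hn]
      · simp [π, smul_smul, hn]
  obtain ⟨g, hg⟩ := exists_descend π hπ (c.comp ⟨fun p => (p.1, f p.2), by fun_prop⟩) (by
    rintro ⟨s, x⟩ ⟨t, y⟩ h
    obtain rfl : s = t := Subtype.ext (by rw [← hnorm (s, x), h, hnorm])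
    by_cases hs : s = 0
    · simp [hs, h0]
    · have hs' : (s : ℝ) ≠ 0 := fun h => hs (Subtype.ext h)
      have : x = y := Subtype.ext (smul_right_injective E hs' (congrArg Subtype.val h))
      rw [this])
  refine ⟨g, fun x => ?_⟩
  have : (⟨x.1, sphere_subset_closedBall x.2⟩ : closedBall (0 : E) 1) = π (1, x) :=
    Subtype.ext (by simp [π])
  rw [this, hg]
  simp [h1]

theorem exists_extend_ball {m : ℕ} (q : CubeCollapse (m + 3))
    (f : C(sphere (0 : EuclideanSpace ℝ (Fin (m + 3 + 1))) 1, LineTriple)) :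
    ∃ g : C(closedBall (0 : EuclideanSpace ℝ (Fin (m + 3 + 1))) 1, LineTriple),
      ∀ x : sphere (0 : EuclideanSpace ℝ (Fin (m + 3 + 1))) 1,
        g ⟨x.1, sphere_subset_closedBall x.2⟩ = f x := by
  obtain ⟨F, hF⟩ := exists_lift_sphere q f
  obtain ⟨c, hc0, hc1⟩ := exists_contraction_nonzeroSeq
  let C : C(I × Triple, Triple) :=
    ⟨fun p => (c (p.1, p.2.1), c (p.1, p.2.2.1), c (p.1, p.2.2.2)), by fun_prop⟩
  obtain ⟨g, hg⟩ := exists_extend_ball_of_contraction C _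
    (fun z => by simp only [C, ContinuousMap.coe_mk, hc0]; rfl)
    (fun z => by simp [C, hc1]) F
  exact ⟨⟨fun x => toLines (g x), by fun_prop⟩, fun x => by simp [hg, hF]⟩

/-! ### The action on line triples -/

/-- The cyclic permutation of the components, followed by a rotation of the first one. -/
def turn (y : Triple) : Triple := (expSmul (2 * Real.pi / 3 * Complex.I) y.2.2, y.1, y.2.1)

/-- The effect of `turn` on the exponents of `twist`. -/
def turnExp (D : ℂ × ℂ) : ℂ × ℂ := (-(D.1 + D.2), D.1)

/-- The exponents of the third iterate of `turn`. -/
def thirdExp : ℂ × ℂ := (2 * Real.pi / 3 * Complex.I, 2 * Real.pi / 3 * Complex.I)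

theorem turn_twist (D : ℂ × ℂ) (y : Triple) : turn (twist D y) = twist (turnExp D) (turn y) := by
  simp only [turn, twist, turnExp, expSmul_expSmul]
  congr 2
  ring

theorem turn_turn_turn (y : Triple) : turn (turn (turn y)) = twist thirdExp y := by
  -- Each vector is multiplied by ω, whereas `twist` multiplies the first by ω⁻², which is the same.
  have h : expSmul (2 * Real.pi / 3 * Complex.I) y.1 =
      expSmul (-(2 * Real.pi / 3 * Complex.I + 2 * Real.pi / 3 * Complex.I)) y.1 := by
    ext1
    rw [coe_expSmul, coe_expSmul]
    congr 1
    rw [exp_eq_exp_iff_exists_int]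
    exact ⟨1, by push_cast; ring⟩
  simp only [turn, twist, thirdExp]
  rw [h]

@[fun_prop]
theorem continuous_turn : Continuous turn := by
  unfold turn
  fun_prop

/-- The space of line triples, with the action of the cyclic group of order three that permutes
the lines and multiplies the trivialization by a cube root of unity. -/
def lineSpace : Z3Space where
  carrier := LineTriple
  pt := toLines (⟨unitVec 0, unitVec_ne_zero 0⟩, ⟨unitVec 0, unitVec_ne_zero 0⟩,
    ⟨unitVec 0, unitVec_ne_zero 0⟩)
  ω := ⟨Quotient.map turn (by rintro y _ ⟨D, rfl⟩; exact ⟨turnExp D, (turn_twist D y).symm⟩),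
    continuous_turn.quotient_map' _⟩
  ω_cube := by
    rintro ⟨y⟩
    change toLines (turn (turn (turn y))) = toLines y
    rw [turn_turn_turn, toLines_twist]

theorem lineSpace_ω_toLines (y : Triple) : lineSpace.ω (toLines y) = toLines (turn y) := rfl

/-! ### Extending equivariant maps over the skeleta -/

theorem IsEquivariant.iterate {X Y : Z3Space} {f : C(X, Y)} (hf : IsEquivariant f) (n : ℕ) (x : X) :
    f (X.ω^[n] x) = Y.ω^[n] (f x) :=
  (Function.Semiconj.iterate_right (f := f) (ga := X.ω) (gb := Y.ω) hf n) x

/-- One extension per orbit of discs suffices: its translates by ω fit the other two, as `f` is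
equivariant. -/
theorem exists_extend_attach {Y Z : Z3Space} {E : Type} [NormedAddCommGroup E] {J : Type}
    (γ : J → C(sphere (0 : E) 1, Y)) (f : C(Y, Z)) (hf : IsEquivariant f)
    (h : ∀ i, ∃ g : C(closedBall (0 : E) 1, Z), ∀ x : sphere (0 : E) 1,
      g ⟨x.1, sphere_subset_closedBall x.2⟩ = f (γ i x)) :
    ∃ F : C(attach Y γ, Z), IsEquivariant F ∧ ∀ y, F (attachIncl Y γ y) = f y := by
  choose g hg using h
  let F₀ : Y ⊕ (Σ _ : J × ZMod 3, closedBall (0 : E) 1) → Z :=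
    Sum.elim f fun p => Z.ω^[p.1.2.val] (g p.1.1 p.2)
  have hF₀ : Continuous F₀ := by
    refine f.continuous.sumElim (continuous_sigma fun p => ?_)
    exact (Z.ω.continuous.iterate p.2.val).comp (g p.1).continuous
  have hrel : ∀ p q, AttachRel Y γ p q → F₀ p = F₀ q := by
    rintro _ _ ⟨i, j, x⟩
    change Z.ω^[j.val] (g i _) = f _
    rw [hg, IsEquivariant.iterate hf]
  refine ⟨⟨Quot.lift F₀ hrel, continuous_quot_lift _ hF₀⟩, ?_, fun y => rfl⟩
  rintro ⟨y | ⟨⟨i, j⟩, x⟩⟩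
  · exact hf y
  · exact attach_shift Z j (g i x)

/-- The map is z ↦ [z e₀, e₀, e₀]. Turning gives [ω e₀, z e₀, e₀], and the scalar z may be moved
back to the first slot. Over the disc, z e₀ + (1 - |z|) e₁ never vanishes. -/
theorem exists_equivariant_circle : ∃ f : C(circle3, lineSpace), IsEquivariant f ∧
    ∃ g : C(closedBall (0 : ℂ) 1, lineSpace), ∀ x : sphere (0 : ℂ) 1,
      g ⟨x.1, sphere_subset_closedBall x.2⟩ = f (sphereToCircle x) := by
  let e : NonzeroSeq := ⟨unitVec 0, unitVec_ne_zero 0⟩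
  let g : C(closedBall (0 : ℂ) 1, lineSpace) :=
    ⟨fun x => toLines (⟨x.1 • unitVec 0 + ((1 - ‖x.1‖ : ℝ) : ℂ) • unitVec 1, by
      intro h
      have h0 := congrArg (coord 0) h
      have h1 := congrArg (coord 1) h
      simp [coord_unitVec] at h0 h1
      simp [h0] at h1⟩, e, e), by
      refine continuous_toLines.comp ?_
      fun_prop⟩
  have hval : ∀ z : Circle, toLines (⟨(z : ℂ) • unitVec 0, smul_ne_zero z.coe_ne_zero
      (unitVec_ne_zero 0)⟩, e, e) =
        g ⟨(z : ℂ), by rw [mem_closedBall_zero_iff, Circle.norm_coe]⟩ := by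
    intro z
    refine congrArg toLines (Prod.ext (Subtype.ext ?_) rfl)
    change (z : ℂ) • unitVec 0 = (z : ℂ) • unitVec 0 + ((1 - ‖(z : ℂ)‖ : ℝ) : ℂ) • unitVec 1
    rw [Circle.norm_coe, sub_self, ofReal_zero, zero_smul, add_zero]
  refine ⟨⟨fun z : Circle => toLines (⟨(z : ℂ) • unitVec 0, smul_ne_zero z.coe_ne_zero
      (unitVec_ne_zero 0)⟩, e, e), ?_⟩, ?_, g, fun x => (hval (sphereToCircle x)).symm⟩
  · refine continuous_toLines.comp ?_
    fun_prop
  · intro (z : Circle)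
    change toLines (⟨((omega3 * z : Circle) : ℂ) • unitVec 0, _⟩, e, e) =
      toLines (turn (⟨(z : ℂ) • unitVec 0, _⟩, e, e))
    rw [toLines_eq_iff]
    refine ⟨(log (z : ℂ), 0), ?_⟩
    have hz := z.coe_ne_zero
    refine Prod.ext (Subtype.ext ?_) (Prod.ext (Subtype.ext ?_) (Subtype.ext ?_))
    · simp only [twist, turn, coe_expSmul, smul_smul, add_zero, exp_neg, exp_log hz, Circle.coe_mul,
        omega3, Circle.coe_exp, e]
      rw [mul_comm, mul_assoc, mul_inv_cancel₀ hz, mul_one]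
      push_cast
      rfl
    · simp [twist, turn, exp_log hz, e]
    · simp [twist, turn]

theorem exists_equivariant_Y2 : ∃ f : C(Y2, lineSpace), IsEquivariant f := by
  obtain ⟨f, hf, g, hg⟩ := exists_equivariant_circle
  obtain ⟨F, hF, -⟩ := exists_extend_attach (fun _ : Unit => sphereToCircle) f hf fun _ => ⟨g, hg⟩
  exact ⟨F, hF⟩

theorem exists_extend_skeleton (c : GeneratorChoice) (m : ℕ) (f : C(skeleton c m, lineSpace))
    (hf : IsEquivariant f) : ∃ F : C(skeleton c (m + 1), lineSpace), IsEquivariant F ∧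
      ∀ y, F (skeletonIncl c m y) = f y :=
  exists_extend_attach (c m (skeleton c m)).γ f hf fun i =>
    exists_extend_ball (c m (skeleton c m)).collapse (f.comp ((c m (skeleton c m)).γ i))

theorem exists_equivariant_P2 (c : GeneratorChoice) :
    ∃ f : C(P2 c, lineSpace), IsEquivariant f := by
  obtain ⟨f₀, hf₀⟩ := exists_equivariant_Y2
  choose ext hext hincl using exists_extend_skeleton c
  let s : ∀ m, {f : C(skeleton c m, lineSpace) // IsEquivariant f} := fun m =>
    Nat.rec ⟨f₀, hf₀⟩ (fun m f => ⟨ext m f.1 f.2, hext m f.1 f.2⟩) m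
  have hs : ∀ m y, (s (m + 1)).1 (skeletonIncl c m y) = (s m).1 y := fun m y =>
    hincl m (s m).1 (s m).2 y
  refine ⟨⟨Quot.lift (fun p => (s p.1).1 p.2) ?_, continuous_quot_lift _ ?_⟩, ?_⟩
  · rintro _ _ ⟨m, y⟩
    exact (hs m y).symm
  · exact continuous_sigma fun m => (s m).1.continuous
  · rintro ⟨m, y⟩
    exact (s m).2 y

/-! ### Lifting equivariant loops -/

theorem locallyFinite_Icc_intCast : LocallyFinite fun n : ℤ => Set.Icc (n : ℝ) (n + 1) := by
  intro x
  refine ⟨Set.Ioo (x - 1) (x + 1), Ioo_mem_nhds (by linarith) (by linarith),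
    (Set.finite_Icc (⌊x⌋ - 3) (⌊x⌋ + 3)).subset ?_⟩
  rintro n ⟨y, ⟨h1, h2⟩, h3, h4⟩
  have h5 := Int.floor_le x
  have h6 := Int.lt_floor_add_one x
  constructor
  · have : ((⌊x⌋ - 3 : ℤ) : ℝ) ≤ n := by push_cast; linarith
    exact_mod_cast this
  · have : (n : ℝ) ≤ ((⌊x⌋ + 3 : ℤ) : ℝ) := by push_cast; linarith
    exact_mod_cast this

/-- The map `turn` as a homeomorphism. -/
def turnHomeomorph : Triple ≃ₜ Triple where
  toFun := turn
  invFun y := (y.2.1, y.2.2, expSmul (-(2 * Real.pi / 3 * Complex.I)) y.1)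
  left_inv y := by simp [turn]
  right_inv y := by simp [turn]
  continuous_toFun := continuous_turn
  continuous_invFun := by fun_prop

theorem Z3Space.ω_injective (X : Z3Space) : Function.Injective X.ω := fun x y h => by
  rw [← X.ω_cube x, h, X.ω_cube]

theorem exists_equivariant_lift (l : C(ℝ, LineTriple)) (hl : ∀ x, l (x + 1) = lineSpace.ω (l x)) :
    ∃ y : C(ℝ, Triple), (∀ x, toLines (y x) = l x) ∧ ∀ x, y (x + 1) = turn (y x) := by
  obtain ⟨Y, hY⟩ := exists_lift_of_contractible (l.comp ⟨((↑) : I → ℝ), continuous_subtype_val⟩)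
  obtain ⟨D, hD⟩ : ∃ D, twist D (turn (Y 0)) = Y 1 := by
    rw [← toLines_eq_iff, ← lineSpace_ω_toLines, hY, hY]
    simpa using (hl 0).symm
  -- Spreading the twist `D` over the interval makes the end point the turn of the start, so the
  -- translates under powers of `turn` fit together.
  let Z : I → Triple := fun s => twist (-((s : ℝ) : ℂ) • D) (Y s)
  have hZc : Continuous Z := by fun_prop
  have hZ : Z 1 = turn (Z 0) := by simp [Z, ← hD]
  let y : ℝ → Triple := fun x =>
    (turnHomeomorph ^ ⌊x⌋ : Triple ≃ₜ Triple) (Z (Set.projIcc 0 1 zero_le_one (x - ⌊x⌋)))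
  have hy : Continuous y := by
    refine locallyFinite_Icc_intCast.continuous (iUnion_Icc_intCast ℝ) (fun _ => isClosed_Icc)
      fun n => ?_
    have hcont : Continuous fun x : ℝ => (turnHomeomorph ^ n : Triple ≃ₜ Triple)
        (Z (Set.projIcc 0 1 zero_le_one (x - n))) :=
      (turnHomeomorph ^ n : Triple ≃ₜ Triple).continuous.comp
        (hZc.comp (continuous_projIcc.comp (by fun_prop)))
    refine hcont.continuousOn.congr fun x hx => ?_
    -- At the right end the floor is already `n + 1`; there the two formulas agree by `hZ`.
    rcases eq_or_lt_of_le hx.2 with h | h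
    · have hf : ⌊x⌋ = n + 1 := by
        rw [h]
        exact_mod_cast Int.floor_intCast (n + 1)
      simp only [y, hf]
      rw [h]
      simp only [Int.cast_add, Int.cast_one, sub_self, add_sub_cancel_left, Set.projIcc_left,
        Set.projIcc_right, zpow_add, zpow_one]
      exact congrArg (turnHomeomorph ^ n : Triple ≃ₜ Triple) hZ.symm
    · have hf : ⌊x⌋ = n := Int.floor_eq_iff.2 ⟨hx.1, h⟩
      simp only [y, hf]
  have hpow : ∀ (n : ℤ) (s : I), toLines ((turnHomeomorph ^ n : Triple ≃ₜ Triple) (Z s)) =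
      l (n + s) := by
    intro n s
    have hstep : ∀ n : ℤ, toLines ((turnHomeomorph ^ (n + 1) : Triple ≃ₜ Triple) (Z s)) =
        lineSpace.ω (toLines ((turnHomeomorph ^ n : Triple ≃ₜ Triple) (Z s))) := by
      intro n
      rw [add_comm, zpow_add, zpow_one]
      rfl
    induction n using Int.induction_on with
    | zero => simpa [Z] using hY s
    | succ n ih =>
      rw [hstep, ih, ← hl]
      push_cast
      congr 1
      ring
    | pred n ih =>
      apply lineSpace.ω_injective
      rw [← hstep, sub_add_cancel, ih, ← hl]
      push_cast
      congr 1
      ring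
  refine ⟨⟨y, hy⟩, fun x => ?_, fun x => ?_⟩
  · simp only [y, ContinuousMap.coe_mk, hpow]
    rw [Set.projIcc_of_mem zero_le_one (⟨Int.fract_nonneg x, (Int.fract_lt_one x).le⟩ :
      x - ⌊x⌋ ∈ Set.Icc (0 : ℝ) 1)]
    simp
  · simp only [y, ContinuousMap.coe_mk, Int.floor_add_one]
    rw [add_comm ⌊x⌋ 1, zpow_add, zpow_one]
    have : x + 1 - ((1 + ⌊x⌋ : ℤ) : ℝ) = x - ⌊x⌋ := by push_cast; ring
    rw [this]
    rfl

theorem add_three_mul_of_equivariant {y : ℝ → Triple} (hy : ∀ x, y (x + 1) = turn (y x)) (a : ℕ)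
    (x : ℝ) : y (x + 3 * a) = twist ((a : ℂ) • thirdExp) (y x) := by
  induction a with
  | zero => simp
  | succ a ih =>
    have : x + 3 * ((a + 1 : ℕ) : ℝ) = x + 3 * a + 1 + 1 + 1 := by push_cast; ring
    rw [this, hy, hy, hy, turn_turn_turn, ih, twist_twist]
    congr 1
    push_cast
    module

/-! ### The invariant of a map from the torus -/

theorem eq_of_exp_eq_one_prod {X : Type*} [TopologicalSpace X] [PreconnectedSpace X]
    {f : X → ℂ × ℂ} (hf : Continuous f) (h : ∀ x, exp (f x).1 = 1 ∧ exp (f x).2 = 1) (x y : X) :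
    f x = f y :=
  Prod.ext
    (eq_of_exp_eq_exp (f := fun x => (f x).1) (by fun_prop)
      (fun x y => (h x).1.trans (h y).1.symm) x y)
    (eq_of_exp_eq_exp (f := fun x => (f x).2) (by fun_prop)
      (fun x y => (h x).2.trans (h y).2.symm) x y)

theorem exp_sub_eq_one_of_twist_eq {D D' : ℂ × ℂ} {y : Triple} (h : twist D y = twist D' y) :
    exp (D - D').1 = 1 ∧ exp (D - D').2 = 1 := by
  obtain ⟨h1, h2⟩ := exp_eq_of_twist_eq h
  simp [exp_sub, h1, h2]

@[fun_prop]
theorem continuous_turnExp : Continuous turnExp := by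
  unfold turnExp
  fun_prop

/-- `D` compares `Y` with the equivariant lift `y`, whose twists along both sides are known. The
discrepancies `m` and `k` take values in (2πiℤ)² and are constant, and `D` cancels at the corners.
-/
theorem monodromy_defect_eq {y : C(ℝ, Triple)} (hy : ∀ x, y (x + 1) = turn (y x)) {A A' a : ℕ}
    (hA : A = 1 + 3 * A') (Y : C(I × I, Triple))
    (hY : ∀ s t : I, toLines (y (A * s + 3 * (a * t))) = toLines (Y (s, t)))
    (G K : C(I, ℂ × ℂ)) (hG : ∀ s, Y (s, 1) = twist (G s) (Y (s, 0)))
    (hK : ∀ t, Y (1, t) = twist (K t) (turn (Y (0, t)))) :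
    ∃ m : ℂ × ℂ, (exp m.1 = 1 ∧ exp m.2 = 1) ∧
      G 1 - turnExp (G 0) - (K 1 - K 0) =
        ((a : ℂ) • thirdExp + m) - turnExp ((a : ℂ) • thirdExp + m) := by
  obtain ⟨D, hD⟩ := exists_twist_of_toLines_eq
    (y.comp ⟨fun p : I × I => (A * p.1 + 3 * (a * p.2) : ℝ), by fun_prop⟩) Y (fun p => hY p.1 p.2)
  have hD' : ∀ s t : I, Y (s, t) = twist (D (s, t)) (y (A * s + 3 * (a * t))) := fun s t => hD (s, t)
  let m : I → ℂ × ℂ := fun s => (G s + D (s, 0)) - (D (s, 1) + (a : ℂ) • thirdExp)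
  have hm : ∀ s, exp (m s).1 = 1 ∧ exp (m s).2 = 1 := by
    intro s
    refine exp_sub_eq_one_of_twist_eq (y := y (A * s)) ?_
    have h1 := hG s
    rw [hD', hD'] at h1
    simp only [Set.Icc.coe_one, Set.Icc.coe_zero, mul_one, mul_zero, add_zero] at h1
    rw [add_three_mul_of_equivariant hy, twist_twist, twist_twist] at h1
    exact h1.symm
  let k : I → ℂ × ℂ := fun t =>
    (K t + turnExp (D (0, t))) - (D (1, t) + turnExp ((A' : ℂ) • thirdExp))
  have hk : ∀ t, exp (k t).1 = 1 ∧ exp (k t).2 = 1 := by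
    intro t
    refine exp_sub_eq_one_of_twist_eq (y := turn (y (3 * (a * t)))) ?_
    have h1 := hK t
    rw [hD', hD'] at h1
    simp only [Set.Icc.coe_one, Set.Icc.coe_zero, mul_one, mul_zero, zero_add] at h1
    have h2 : (A : ℝ) + 3 * (a * t) = 3 * (a * t) + 3 * A' + 1 := by rw [hA]; push_cast; ring
    rw [h2, hy, add_three_mul_of_equivariant hy, turn_twist, turn_twist, twist_twist,
      twist_twist] at h1
    exact h1.symm
  have hm01 : m 1 = m 0 := eq_of_exp_eq_one_prod (by fun_prop) hm 1 0
  have hk01 : k 1 = k 0 := eq_of_exp_eq_one_prod (by fun_prop) hk 1 0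
  refine ⟨m 0, hm 0, ?_⟩
  have e1 := congrArg Prod.fst hm01
  have e2 := congrArg Prod.snd hm01
  have e3 := congrArg Prod.fst hk01
  have e4 := congrArg Prod.snd hk01
  simp only [m, k, turnExp, Prod.fst_add, Prod.snd_add, Prod.fst_sub, Prod.snd_sub] at e1 e2 e3 e4
  refine Prod.ext ?_ ?_
  · simp only [m, turnExp, Prod.fst_add, Prod.snd_add, Prod.fst_sub, Prod.snd_sub]
    linear_combination e1 - e3
  · simp only [m, turnExp, Prod.fst_add, Prod.snd_add, Prod.fst_sub, Prod.snd_sub]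
    linear_combination e2 - e4

theorem modEq_of_homotopy {l : C(ℝ, LineTriple)} (hl : ∀ x, l (x + 1) = lineSpace.ω (l x))
    (F : C(I × I × I, LineTriple)) (h₁ : ∀ r s, F (r, s, 1) = F (r, s, 0))
    (h₂ : ∀ r t, F (r, 1, t) = lineSpace.ω (F (r, 0, t))) {A A' a B B' b : ℕ}
    (hA : A = 1 + 3 * A') (hB : B = 1 + 3 * B')
    (hF₀ : ∀ s t : I, F (0, s, t) = l (A * s + 3 * (a * t)))
    (hF₁ : ∀ s t : I, F (1, s, t) = l (B * s + 3 * (b * t))) :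
    (a : ZMod 3) = b := by
  obtain ⟨y, hyl, hy⟩ := exists_equivariant_lift l hl
  obtain ⟨Y, hY⟩ := exists_lift_of_contractible F
  obtain ⟨G, hG⟩ := exists_twist_of_toLines_eq
    (Y.comp ⟨fun p : I × I => (p.1, p.2, 0), by fun_prop⟩)
    (Y.comp ⟨fun p : I × I => (p.1, p.2, 1), by fun_prop⟩) (fun p => by simp [hY, h₁])
  obtain ⟨K, hK⟩ := exists_twist_of_toLines_eq
    ((⟨turn, continuous_turn⟩ : C(Triple, Triple)).comp
      (Y.comp ⟨fun p : I × I => (p.1, 0, p.2), by fun_prop⟩))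
    (Y.comp ⟨fun p : I × I => (p.1, 1, p.2), by fun_prop⟩)
    (fun p => by
      simp only [ContinuousMap.comp_apply, ContinuousMap.coe_mk, ← lineSpace_ω_toLines, hY, h₂]
      rfl)
  replace hG : ∀ r s, Y (r, s, 1) = twist (G (r, s)) (Y (r, s, 0)) := fun r s => hG (r, s)
  replace hK : ∀ r t, Y (r, 1, t) = twist (K (r, t)) (turn (Y (r, 0, t))) := fun r t => hK (r, t)
  -- Both routes from `Y (r, 0, 0)` to `Y (r, 1, 1)` give the same triple, so their exponents differ
  -- by an element of (2πiℤ)².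
  let ν : I → ℂ × ℂ := fun r =>
    G (r, 1) - turnExp (G (r, 0)) - (K (r, 1) - K (r, 0))
  have hν : ∀ r, exp (ν r).1 = 1 ∧ exp (ν r).2 = 1 := by
    intro r
    have h := hG r 1
    rw [hK, hK, hG, turn_twist, twist_twist, twist_twist] at h
    have h' := exp_sub_eq_one_of_twist_eq h.symm
    have e : G (r, 1) + K (r, 0) - (K (r, 1) + turnExp (G (r, 0))) = ν r := by
      simp only [ν]
      abel
    rwa [e] at h'
  have hν01 : ν 0 = ν 1 := eq_of_exp_eq_one_prod (by fun_prop) hν 0 1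
  obtain ⟨m, hm, hma⟩ := monodromy_defect_eq (a := a) hy hA (Y.comp ⟨fun p => (0, p), by fun_prop⟩)
    (fun s t => by simp [hyl, hY, hF₀]) (G.comp ⟨fun s => (0, s), by fun_prop⟩)
    (K.comp ⟨fun s => (0, s), by fun_prop⟩) (hG 0) (hK 0)
  obtain ⟨n, hn, hnb⟩ := monodromy_defect_eq (a := b) hy hB (Y.comp ⟨fun p => (1, p), by fun_prop⟩)
    (fun s t => by simp [hyl, hY, hF₁]) (G.comp ⟨fun s => (1, s), by fun_prop⟩)
    (K.comp ⟨fun s => (1, s), by fun_prop⟩) (hG 1) (hK 1)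
  have key := hma.symm.trans (hν01.trans hnb)
  have e1 := congrArg Prod.fst key
  have e2 := congrArg Prod.snd key
  simp only [turnExp, thirdExp, Prod.fst_add, Prod.snd_add, Prod.fst_sub, Prod.snd_sub,
    Prod.smul_fst, Prod.smul_snd, smul_eq_mul] at e1 e2
  obtain ⟨i, hi⟩ := exp_eq_one_iff.1 hm.1
  obtain ⟨j, hj⟩ := exp_eq_one_iff.1 hn.1
  -- The coordinates of `d - turnExp d` differ by `3 * d.1`, so `(e1 - e2) / 3` isolates the first
  -- coordinate.
  have e3 : ((a : ℂ) - b - 3 * (j - i)) * (2 * Real.pi / 3 * Complex.I) = 0 := by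
    linear_combination (e1 - e2) / 3 - hi + hj
  have e4 : (a : ℂ) - b - 3 * (j - i) = 0 := by
    refine (mul_eq_zero.1 e3).resolve_right ?_
    simp [Real.pi_ne_zero]
  have e5 : (a : ℤ) - b - 3 * (j - i) = 0 := by exact_mod_cast e4
  have e6 : ((a : ℤ) : ZMod 3) = ((b : ℤ) : ZMod 3) :=
    (ZMod.intCast_eq_intCast_iff_dvd_sub _ _ 3).2 ⟨i - j, by push_cast; linarith⟩
  simpa using e6

theorem prod_circleExp_zpow {n : ℕ} (i₀ : Fin n) (k : Fin n → ℕ) (s t : ℝ) :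
    ∏ i, Circle.exp (2 * Real.pi * (s / 3) + if i = i₀ then 2 * Real.pi * t else 0) ^ (k i : ℤ) =
      Circle.exp (2 * Real.pi * (((∑ i, k i : ℕ) * s + 3 * (k i₀ * t)) / 3)) := by
  have h : ∀ i, Circle.exp (2 * Real.pi * (s / 3) + if i = i₀ then 2 * Real.pi * t else 0) ^
      (k i : ℤ) = Circle.exp (k i * (2 * Real.pi * (s / 3)) +
        if i = i₀ then k i * (2 * Real.pi * t) else 0) := by
    intro i
    rw [← Circle.exp_intCast_mul]
    congr 1
    split_ifs <;> push_cast <;> ring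
  have hsum : ∀ (S : Finset (Fin n)) (u : Fin n → ℝ),
      ∏ i ∈ S, Circle.exp (u i) = Circle.exp (∑ i ∈ S, u i) := by
    intro S u
    induction S using Finset.induction_on with
    | empty => simp
    | insert i S hi ih => rw [Finset.prod_insert hi, Finset.sum_insert hi, Circle.exp_add, ih]
  simp only [h]
  rw [hsum, Finset.sum_add_distrib, ← Finset.sum_mul, Finset.sum_ite_eq' Finset.univ i₀]
  congr 1
  simp only [Finset.mem_univ, if_true]
  push_cast
  ring

theorem exists_sum_val_eq {n : ℕ} {α : Fin n → ZMod 3} (hα : α ∈ AffineTuples n) :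
    ∃ A', ∑ i, (α i).val = 1 + 3 * A' := by
  have h : ((∑ i, (α i).val : ℕ) : ZMod 3) = (1 : ℕ) := by
    have : ∑ i, α i = 1 := hα
    simpa using this
  rw [ZMod.natCast_eq_natCast_iff] at h
  have h' : (∑ i, (α i).val) % 3 = 1 := h
  exact ⟨(∑ i, (α i).val) / 3, by omega⟩

theorem omega3_mul_circleExp (u : ℝ) :
    omega3 * Circle.exp u = Circle.exp (2 * Real.pi / 3 + u) := by
  rw [omega3, Circle.exp_add]

theorem mainTheorem5 (c : GeneratorChoice) (ι : C(circle3, P2 c))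
    (hι : Topology.IsEmbedding ι) (hιω : IsEquivariant ι)
    (n : ℕ) (α β : Fin n → ZMod 3) (hα : α ∈ AffineTuples n) (hβ : β ∈ AffineTuples n)
    (h : EquivariantlyHomotopic (monomialMap3 ι α) (monomialMap3 ι β)) :
    α = β := by
  obtain ⟨Φ, hΦ⟩ := exists_equivariant_P2 c
  obtain ⟨h, hω⟩ := h
  obtain ⟨A', hA⟩ := exists_sum_val_eq hα
  obtain ⟨B', hB⟩ := exists_sum_val_eq hβ
  funext i₀
  -- The parameter counts thirds of a turn, so adding 1 is the action of ω.
  let e : C(ℝ, circle3) :=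
    ⟨fun x => Circle.exp (2 * Real.pi * (x / 3)), Circle.exp.continuous.comp (by fun_prop)⟩
  let l : C(ℝ, LineTriple) := (Φ.comp ι).comp e
  have hl : ∀ x, l (x + 1) = lineSpace.ω (l x) := by
    intro x
    have he : e (x + 1) = circle3.ω (e x) := by
      refine Eq.trans ?_ (omega3_mul_circleExp _).symm
      change Circle.exp _ = _
      congr 1
      ring
    change Φ (ι (e (x + 1))) = _
    rw [he, hιω, hΦ]
    rfl
  -- The edges `s = 0` and `s = 1` differ by ω, while `t = 0` and `t = 1` coincide.
  let z : C(I × I, torus n) :=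
    ⟨fun p i => Circle.exp (2 * Real.pi * (p.1 / 3) + if i = i₀ then 2 * Real.pi * p.2 else 0), by
      refine continuous_pi fun i => Circle.exp.continuous.comp ?_
      split_ifs <;> fun_prop⟩
  have hz₁ : ∀ s, z (s, 1) = z (s, 0) := by
    intro s
    funext i
    change Circle.exp (2 * Real.pi * (s / 3) + if i = i₀ then 2 * Real.pi * ((1 : I) : ℝ) else 0) =
      Circle.exp (2 * Real.pi * (s / 3) + if i = i₀ then 2 * Real.pi * ((0 : I) : ℝ) else 0)
    by_cases hi : i = i₀ <;> simp [hi]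
  have hz₂ : ∀ t, z (1, t) = (torus n).ω (z (0, t)) := by
    intro t
    funext i
    refine Eq.trans ?_ (omega3_mul_circleExp _).symm
    change Circle.exp _ = _
    congr 1
    simp only [Set.Icc.coe_one, Set.Icc.coe_zero]
    ring
  let F : C(I × I × I, LineTriple) :=
    Φ.comp (h.toContinuousMap.comp ⟨fun p => (p.1, z p.2), by fun_prop⟩)
  have hF : ∀ r p, F (r, p) = Φ (h (r, z p)) := fun _ _ => rfl
  have hend : ∀ (κ : Fin n → ZMod 3) (s t : I), Φ (monomialMap3 ι κ (z (s, t))) =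
      l ((∑ i, (κ i).val : ℕ) * s + 3 * ((κ i₀).val * t)) := fun κ s t =>
    congrArg (fun w => Φ (ι w)) (prod_circleExp_zpow i₀ (fun i => (κ i).val) s t)
  have key := modEq_of_homotopy hl F (fun r s => by rw [hF, hF, hz₁])
    (fun r t => by rw [hF, hF, hz₂, hω, hΦ]) hA hB
    (fun s t => by rw [hF, h.apply_zero, hend])
    (fun s t => by rw [hF, h.apply_one, hend])
  simpa using key

end
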